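/- Let $\sigma(x)=\max\{x,0\}$ be the ReLU function and let $\mu$ be a probability distribution on $\mathbb{R}$ whose support contains the interval $[-r,r]$ for some $r>0$. Then, for every $d\in\mathbb{N}$, the pair $(\sigma,\mu^{d+1})$ is universal, where $\mu^{d+1}$ is the $(d+1)$-fold product of $\mu$ on $\mathbb{R}^{d+1}$. Here a pair $(\phi,\nu)$, with $\phi:\mathbb{R}\to\mathbb{R}$ and $\nu$ a probability distribution on $\mathbb{R}^{d+1}$, is called universal if the following holds. Let $(w_i,b_i)_{i\ge 1}$, with $w_i\in\mathbb{R}^d$ and $b_i\in\mathbb{R}$, be a sequence of i.i.d. random vectors with law $\nu$. Then for any compact set $\mathcal{X}\subseteq\mathbb{R}^d$, any continuous $f:\mathcal{X}\to\mathbb{R}$ and any $\epsilon,\delta\in(0,1)$, there exists a positive integer $n$ such that, with probability at least $1-\delta$, there are $a_1,\dots,a_n\in\mathbb{R}$ (which may depend on the sample) with $$\sup_{x\in\mathcal{X}}\Big|f(x)-\sum_{i=1}^n a_i\,\phi(w_i\cdot x+b_i)\Big|\le\epsilon .$$ -/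

import Mathlib

open MeasureTheory ProbabilityTheory

universe u

/-- The ReLU activation function `σ(x) = max {x, 0}`. -/
noncomputable def relu (x : ℝ) : ℝ := max x 0

/-- The neuron `φ (w ⋅ x + b)` with activation `φ`, input `x ∈ ℝ^d` and weight vector
`v = (w, b) ∈ ℝ^(d+1)`: the first `d` coordinates of `v` are `w` and the last one is `b`. -/
def neuron (φ : ℝ → ℝ) {d : ℕ} (v : Fin (d + 1) → ℝ) (x : Fin d → ℝ) : ℝ :=
  φ ((∑ j : Fin d, v j.castSucc * x j) + v (Fin.last d))

/-- `Approximates φ X f ε v`: for weights `v₁, …, vₙ` there are readout coefficients `a₁, …, aₙ`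
with `sup_{x ∈ X} |f x - ∑ᵢ aᵢ φ(wᵢ ⋅ x + bᵢ)| ≤ ε`. -/
def Approximates (φ : ℝ → ℝ) {d n : ℕ} (X : Set (Fin d → ℝ)) (f : C(X, ℝ)) (ε : ℝ)
    (v : Fin n → Fin (d + 1) → ℝ) : Prop :=
  ∃ a : Fin n → ℝ, ∀ x : X, |f x - ∑ i, a i * neuron φ (v i) (x : Fin d → ℝ)| ≤ ε

/-- The pair `(φ, ν)`, with `ν` a probability distribution on `ℝ^(d+1)`, is universal: for i.i.d.
weights `W₀, W₁, …` with law `ν` (on any probability space), any compact `X ⊆ ℝ^d`, any `f ∈ C(X)`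
and any `ε, δ ∈ (0,1)`, there is a positive `n` such that, with probability at least `1 - δ`, the
first `n` weights admit coefficients that approximate `f` on `X` up to `ε`.

The probability bound is put on the failure event; for an event that is not known to be measurable
this is the stronger way to say "with probability at least `1 - δ`", as it bounds the outer measure
of the complement. -/
def IsUniversalPair {d : ℕ} (φ : ℝ → ℝ) (ν : Measure (Fin (d + 1) → ℝ)) : Prop :=
  ∀ (Ω : Type u) [MeasurableSpace Ω] (P : Measure Ω) [IsProbabilityMeasure P]
    (W : ℕ → Ω → Fin (d + 1) → ℝ),
    (∀ i, HasLaw (W i) ν P) → iIndepFun W P →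
    ∀ X : Set (Fin d → ℝ), IsCompact X → ∀ f : C(X, ℝ),
    ∀ ε ∈ Set.Ioo (0 : ℝ) 1, ∀ δ ∈ Set.Ioo (0 : ℝ) 1,
    ∃ n : ℕ, 0 < n ∧
      P {ω | ¬ Approximates φ X f ε (fun i : Fin n => W i ω)} ≤ ENNReal.ofReal δ

/-! Density: functions `x ↦ exp (w ⋅ x)` span a dense subspace of `C(X, ℝ)` by Stone–Weierstrass,
and Taylor's formula with integral remainder writes each as an integral of ReLU neurons plus two
further neurons. Positive homogeneity then shrinks all weights into a small ball. Probability: an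
approximating finite network tolerates perturbed weights, and a ball around each of its weights has
positive mass `p`. All `n` samples miss that ball with probability `(1 - p)^n → 0`; a union bound
over the finitely many balls concludes. -/

theorem continuous_relu : Continuous relu := continuous_id.max continuous_const

theorem relu_mul_of_nonneg {c : ℝ} (hc : 0 ≤ c) (t : ℝ) : relu (c * t) = c * relu t := by
  simp [relu, mul_max_of_nonneg _ _ hc]

section NeuronMap

variable {d : ℕ} (X : Set (Fin d → ℝ))

variable {X} in
theorem continuous_sum_mul_coe {Y : Type*} [TopologicalSpace Y] {w : Y → Fin d → ℝ} {x : Y → X}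
    (hw : Continuous w) (hx : Continuous x) :
    Continuous fun y => ∑ j, w y j * (x y : Fin d → ℝ) j :=
  continuous_finsetSum _ fun j _ => ((continuous_apply j).comp hw).mul
    ((continuous_apply j).comp (continuous_subtype_val.comp hx))

/-- The ReLU neuron with weight vector `v`, as a continuous function on `X`. -/
noncomputable def neuronMap (v : Fin (d + 1) → ℝ) : C(X, ℝ) where
  toFun x := neuron relu v x
  continuous_toFun := continuous_relu.comp
    ((continuous_sum_mul_coe continuous_const continuous_id).add continuous_const)

theorem neuronMap_apply (v : Fin (d + 1) → ℝ) (x : X) :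
    neuronMap X v x = neuron relu v x := rfl

theorem continuous_neuronMap : Continuous (neuronMap X) := by
  refine ContinuousMap.continuous_of_continuous_uncurry _ ?_
  exact continuous_relu.comp
    ((continuous_sum_mul_coe (w := fun p : (Fin (d + 1) → ℝ) × X => fun j => p.1 j.castSucc)
      (by fun_prop) continuous_snd).add (by fun_prop))

theorem neuronMap_smul {c : ℝ} (hc : 0 ≤ c) (v : Fin (d + 1) → ℝ) :
    neuronMap X (c • v) = c • neuronMap X v := by
  ext x
  simp only [neuronMap, neuron, ContinuousMap.coe_mk, ContinuousMap.smul_apply, smul_eq_mul,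
    Pi.smul_apply, mul_assoc, ← Finset.mul_sum, ← mul_add, relu_mul_of_nonneg hc]

/-- The function `x ↦ exp (w ⋅ x)` on `X`, as a monoid homomorphism in `w`. -/
noncomputable def expRidge : Multiplicative (Fin d → ℝ) →* C(X, ℝ) where
  toFun w := ⟨fun x => Real.exp (∑ j, w.toAdd j * (x : Fin d → ℝ) j),
    Real.continuous_exp.comp (continuous_sum_mul_coe continuous_const continuous_id)⟩
  map_one' := by ext x; simp
  map_mul' w w' := by
    ext x
    simp [add_mul, Finset.sum_add_distrib, Real.exp_add]

theorem expRidge_apply (w : Multiplicative (Fin d → ℝ)) (x : X) :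
    expRidge X w x = Real.exp (∑ j, w.toAdd j * (x : Fin d → ℝ) j) := rfl

theorem topologicalClosure_span_expRidge [CompactSpace X] :
    (Submodule.span ℝ (Set.range (expRidge X))).topologicalClosure = ⊤ := by
  have hsep : (Algebra.adjoin ℝ (Set.range (expRidge X))).SeparatesPoints := by
    intro x y hxy
    obtain ⟨j, hj⟩ : ∃ j, (x : Fin d → ℝ) j ≠ (y : Fin d → ℝ) j := by
      by_contra! h
      exact hxy (Subtype.ext (funext h))
    refine ⟨expRidge X (Multiplicative.ofAdd (Pi.single j 1)),
      ⟨_, Algebra.subset_adjoin ⟨_, rfl⟩, rfl⟩, ?_⟩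
    simpa [expRidge_apply, Pi.single_apply] using hj
  -- Exponentials are closed under products, so their span is already an algebra.
  have hspan : Subalgebra.toSubmodule (Algebra.adjoin ℝ (Set.range (expRidge X))) =
      Submodule.span ℝ (Set.range (expRidge X)) := by
    rw [Algebra.adjoin_eq_span, ← MonoidHom.coe_mrange, Submonoid.closure_eq]
  rw [eq_top_iff]
  intro f _
  have hf := ContinuousMap.continuousMap_mem_subalgebra_closure_of_separatesPoints _ hsep f
  rwa [← hspan]

end NeuronMap

/-- Taylor's formula for `exp` at `-M`. The ReLU cuts the integrand off at `s = t`, so the limits do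
not depend on `t`. -/
theorem integral_exp_mul_relu_sub {M t : ℝ} (h₁ : -M ≤ t) (h₂ : t ≤ M) :
    ∫ s in (-M)..M, Real.exp s * relu (t - s) =
      Real.exp t - Real.exp (-M) * (t + M + 1) := by
  have hcont : Continuous fun s => Real.exp s * relu (t - s) :=
    Real.continuous_exp.mul (continuous_relu.comp (by fun_prop))
  rw [← intervalIntegral.integral_add_adjacent_intervals
    (hcont.intervalIntegrable (-M) t) (hcont.intervalIntegrable t M)]
  have hright : ∫ s in t..M, Real.exp s * relu (t - s) = 0 := by
    rw [intervalIntegral.integral_congr (g := fun _ => (0 : ℝ))]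
    · simp
    · intro s hs
      rw [Set.uIcc_of_le h₂] at hs
      simp [relu, hs.1]
  have hleft : ∫ s in (-M)..t, Real.exp s * relu (t - s) =
      ∫ s in (-M)..t, Real.exp s * (t - s) := by
    refine intervalIntegral.integral_congr fun s hs => ?_
    rw [Set.uIcc_of_le h₁] at hs
    simp [relu, hs.2]
  have hderiv : ∀ s ∈ Set.uIcc (-M) t,
      HasDerivAt (fun s => Real.exp s * (t - s + 1)) (Real.exp s * (t - s)) s := by
    intro s _
    have h := (Real.hasDerivAt_exp s).mul (((hasDerivAt_id s).const_sub t).add_const (1 : ℝ))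
    refine h.congr_deriv ?_
    simp only [id]
    ring
  rw [hright, hleft, intervalIntegral.integral_eq_sub_of_hasDerivAt hderiv
    (Continuous.intervalIntegrable (by fun_prop) _ _)]
  ring

/-- The mean of `g` stays in a closed convex set; the integral is a multiple of it. -/
theorem Submodule.intervalIntegral_mem {E : Type*} [NormedAddCommGroup E] [NormedSpace ℝ E]
    [CompleteSpace E] {S : Submodule ℝ E} (hS : IsClosed (S : Set E)) {g : ℝ → E}
    (hg : Continuous g) (hmem : ∀ s, g s ∈ S) {a b : ℝ} (hab : a < b) :
    ∫ s in a..b, g s ∈ S := by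
  have havg : (⨍ s in Set.Ioc a b, g s) ∈ (S : Set E) :=
    S.convex.set_average_mem hS (by simp [hab]) (by simp)
      (Filter.Eventually.of_forall hmem) (hg.integrableOn_Ioc)
  rw [intervalIntegral.integral_of_le hab.le,
    ← measure_smul_setAverage _ (by simp : volume (Set.Ioc a b) ≠ ⊤)]
  exact S.smul_mem _ havg

section Density

variable {d : ℕ} (X : Set (Fin d → ℝ))

theorem exists_linear_bound [CompactSpace X] (w : Fin d → ℝ) :
    ∃ M > 0, ∀ x : X, |∑ j, w j * (x : Fin d → ℝ) j| ≤ M := by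
  have hc : Continuous fun x : X => ∑ j, w j * (x : Fin d → ℝ) j :=
    continuous_sum_mul_coe continuous_const continuous_id
  obtain ⟨C, hC⟩ := (isCompact_range hc).isBounded.exists_norm_le
  exact ⟨max C 1, by positivity, fun x => (hC _ ⟨x, rfl⟩).trans (le_max_left _ _)⟩

theorem expRidge_mem_topologicalClosure_span_neuronMap [CompactSpace X]
    (w : Multiplicative (Fin d → ℝ)) :
    expRidge X w ∈ (Submodule.span ℝ (Set.range (neuronMap X))).topologicalClosure := by
  obtain ⟨M, hM, hwM⟩ := exists_linear_bound X w.toAdd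
  set S := (Submodule.span ℝ (Set.range (neuronMap X))).topologicalClosure with hS
  have hmem : ∀ v, neuronMap X v ∈ S := fun v =>
    Submodule.le_topologicalClosure _ (Submodule.subset_span ⟨v, rfl⟩)
  let g : ℝ → C(X, ℝ) := fun s =>
    Real.exp s • neuronMap X (Fin.snoc (α := fun _ => ℝ) w.toAdd (-s))
  have hg : Continuous g := by
    refine Real.continuous_exp.smul ((continuous_neuronMap X).comp ?_)
    exact Continuous.finSnoc continuous_const continuous_neg
  have hint : ∫ s in (-M)..M, g s ∈ S :=
    Submodule.intervalIntegral_mem (Submodule.isClosed_topologicalClosure _) hg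
      (fun s => S.smul_mem _ (hmem _)) (by linarith)
  -- The affine Taylor part is made of neurons: `w ⋅ x + M ≥ 0` on `X`, and zero weight with bias
  -- `1` gives the constant `1`.
  have hdecomp : expRidge X w = (∫ s in (-M)..M, g s) +
      Real.exp (-M) • (neuronMap X (Fin.snoc (α := fun _ => ℝ) w.toAdd M) +
        neuronMap X (Fin.snoc (α := fun _ => ℝ) 0 1)) := by
    ext x
    have hx := abs_le.1 (hwM x)
    have heval : (∫ s in (-M)..M, g s) x = ∫ s in (-M)..M, g s x :=
      ((ContinuousMap.evalCLM ℝ x).intervalIntegral_comp_comm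
        (hg.intervalIntegrable (-M) M)).symm
    have hgx : ∀ s, g s x =
        Real.exp s * relu ((∑ j, w.toAdd j * (x : Fin d → ℝ) j) - s) := by
      intro s
      simp [g, neuronMap, neuron, sub_eq_add_neg]
    have hr : relu ((∑ j, w.toAdd j * (x : Fin d → ℝ) j) + M) =
        (∑ j, w.toAdd j * (x : Fin d → ℝ) j) + M := max_eq_left (by linarith)
    have h1 : relu 1 = 1 := by simp [relu]
    simp only [ContinuousMap.add_apply, ContinuousMap.smul_apply, heval, hgx,
      integral_exp_mul_relu_sub hx.1 hx.2, expRidge_apply]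
    simp [neuronMap, neuron, hr, h1]
  rw [hdecomp]
  exact S.add_mem hint (S.smul_mem _ (S.add_mem (hmem _) (hmem _)))

theorem neuronMap_mem_span_ball {r : ℝ} (hr : 0 < r) (v : Fin (d + 1) → ℝ) :
    neuronMap X v ∈ Submodule.span ℝ (neuronMap X '' Metric.ball 0 r) := by
  -- The `+ 1` covers `v = 0` and makes the rescaled norm strictly below `r`.
  have hc : 0 < r / (‖v‖ + 1) := by positivity
  have hv : v = (r / (‖v‖ + 1))⁻¹ • (r / (‖v‖ + 1)) • v := (inv_smul_smul₀ hc.ne' v).symm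
  rw [hv, neuronMap_smul X (inv_nonneg.2 hc.le)]
  refine Submodule.smul_mem _ _ (Submodule.subset_span ⟨_, ?_, rfl⟩)
  rw [mem_ball_zero_iff, norm_smul, Real.norm_of_nonneg hc.le, div_mul_eq_mul_div,
    div_lt_iff₀ (by positivity)]
  nlinarith

theorem topologicalClosure_span_neuronMap_ball [CompactSpace X] {r : ℝ} (hr : 0 < r) :
    (Submodule.span ℝ (neuronMap X '' Metric.ball 0 r)).topologicalClosure = ⊤ := by
  rw [eq_top_iff, ← topologicalClosure_span_expRidge X]
  refine Submodule.topologicalClosure_minimal _ ?_ (Submodule.isClosed_topologicalClosure _)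
  rw [Submodule.span_le]
  rintro _ ⟨w, rfl⟩
  refine Submodule.topologicalClosure_mono ?_ (expRidge_mem_topologicalClosure_span_neuronMap X w)
  rw [Submodule.span_le]
  rintro _ ⟨v, rfl⟩
  exact neuronMap_mem_span_ball X hr v

/-- A ReLU network with weights in a small ball approximates `f`, and keeps doing so when its
weights are perturbed. -/
theorem exists_stable_approximation [CompactSpace X] {r : ℝ} (hr : 0 < r) (f : C(X, ℝ)) {ε : ℝ}
    (hε : 0 < ε) :
    ∃ (T : Finset (Fin (d + 1) → ℝ)) (c : T → ℝ), (T : Set (Fin (d + 1) → ℝ)) ⊆ Metric.ball 0 r ∧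
      ∃ ρ > 0, ∀ u : T → Fin (d + 1) → ℝ, (∀ k : T, u k ∈ Metric.ball (k : Fin (d + 1) → ℝ) ρ) →
        ∀ x : X, |f x - ∑ k, c k * neuron relu (u k) (x : Fin d → ℝ)| ≤ ε := by
  have hf : f ∈ closure (Submodule.span ℝ (neuronMap X '' Metric.ball 0 r) : Set C(X, ℝ)) := by
    rw [← Submodule.topologicalClosure_coe, topologicalClosure_span_neuronMap_ball X hr]
    trivial
  obtain ⟨g, hg, hfg⟩ := Metric.mem_closure_iff.1 hf ε hε
  obtain ⟨T, hT, c, rfl⟩ := Submodule.mem_span_image_iff_exists_fun ℝ |>.1 hg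
  refine ⟨T, c, hT, ?_⟩
  have hcont : Continuous fun u : T → Fin (d + 1) → ℝ =>
      dist f (∑ k, c k • neuronMap X (u k)) :=
    continuous_const.dist (continuous_finsetSum _ fun k _ =>
      ((continuous_neuronMap X).comp (continuous_apply k)).const_smul (c k))
  obtain ⟨ρ, hρ, hball⟩ := Metric.isOpen_iff.1 (isOpen_lt hcont continuous_const)
    (fun k : T => (k : Fin (d + 1) → ℝ)) hfg
  refine ⟨ρ, hρ, fun u hu x => ?_⟩
  have hlt : dist f (∑ k, c k • neuronMap X (u k)) < ε :=
    hball ((dist_pi_lt_iff hρ).2 hu)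
  have hx := (ContinuousMap.dist_apply_le_dist x).trans hlt.le
  rw [Real.dist_eq] at hx
  simpa [ContinuousMap.sum_apply, neuronMap_apply] using hx

end Density

/-- If every perturbed network with weights near `T` approximates `f`, then so does any sample of
weights that visits the neighbourhood of every point of `T`. -/
theorem approximates_of_forall_exists_mem_ball {d n : ℕ} {X : Set (Fin d → ℝ)} {f : C(X, ℝ)}
    {ε ρ : ℝ} {φ : ℝ → ℝ} {T : Finset (Fin (d + 1) → ℝ)} {c : T → ℝ}
    (h : ∀ u : T → Fin (d + 1) → ℝ, (∀ k : T, u k ∈ Metric.ball (k : Fin (d + 1) → ℝ) ρ) →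
      ∀ x : X, |f x - ∑ k, c k * neuron φ (u k) (x : Fin d → ℝ)| ≤ ε)
    {v : Fin n → Fin (d + 1) → ℝ} (hv : ∀ k : T, ∃ i, v i ∈ Metric.ball (k : Fin (d + 1) → ℝ) ρ) :
    Approximates φ X f ε v := by
  choose ι hι using hv
  -- One sample may serve several points of `T`: their coefficients add up, and unused samples get
  -- `0`.
  refine ⟨fun i => ∑ k with ι k = i, c k, fun x => ?_⟩
  have hsum : ∑ i, (∑ k with ι k = i, c k) * neuron φ (v i) (x : Fin d → ℝ) =
      ∑ k, c k * neuron φ (v (ι k)) (x : Fin d → ℝ) := by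
    rw [← Finset.sum_fiberwise _ ι]
    refine Finset.sum_congr rfl fun i _ => ?_
    rw [Finset.sum_mul]
    refine Finset.sum_congr rfl fun k hk => ?_
    rw [(Finset.mem_filter.1 hk).2]
  rw [hsum]
  exact h (fun k => v (ι k)) hι x

theorem measure_pi_ball_pos {ι : Type*} [Fintype ι] {μ : Measure ℝ} [SigmaFinite μ]
    {u : ι → ℝ} (hu : ∀ j, u j ∈ μ.support) {ρ : ℝ} (hρ : 0 < ρ) :
    0 < Measure.pi (fun _ : ι => μ) (Metric.ball u ρ) := by
  rw [ball_pi _ hρ, Measure.pi_pi, pos_iff_ne_zero, Finset.prod_ne_zero_iff]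
  exact fun j _ => ((Measure.mem_support_iff_forall _).1 (hu j) _ (Metric.ball_mem_nhds _ hρ)).ne'

theorem measure_forall_lt_notMem {Ω E : Type*} [MeasurableSpace Ω] [MeasurableSpace E]
    {P : Measure Ω} {ν : Measure E} {W : ℕ → Ω → E}
    (hlaw : ∀ i, HasLaw (W i) ν P) (hind : iIndepFun W P) {B : Set E} (hB : MeasurableSet B)
    (n : ℕ) : P {ω | ∀ i < n, W i ω ∉ B} = ν Bᶜ ^ n := by
  have hset : {ω | ∀ i < n, W i ω ∉ B} = ⋂ i ∈ Finset.range n, W i ⁻¹' Bᶜ := by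
    ext ω
    simp
  rw [hset, hind.measure_inter_preimage_eq_mul _ (fun _ _ => hB.compl)]
  have hW : ∀ i, P (W i ⁻¹' Bᶜ) = ν Bᶜ := fun i => (hlaw i).measure_eq hB.compl
  rw [Finset.prod_congr rfl fun i _ => hW i]
  simp

theorem mainTheorem6 (μ : Measure ℝ) [IsProbabilityMeasure μ] (r : ℝ) (hr : 0 < r)
    (hsupp : Set.Icc (-r) r ⊆ μ.support) (d : ℕ) :
    IsUniversalPair.{u} relu (Measure.pi (fun _ : Fin (d + 1) => μ)) := by
  intro Ω _ P _ W hlaw hind X hX f ε hε δ hδ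
  have : CompactSpace X := isCompact_iff_compactSpace.1 hX
  obtain ⟨T, c, hT, ρ, hρ, happrox⟩ := exists_stable_approximation X hr f hε.1
  set ν := Measure.pi (fun _ : Fin (d + 1) => μ) with hν
  have hpow : ∀ k : T, Filter.Tendsto (fun n : ℕ => ν (Metric.ball (k : Fin (d + 1) → ℝ) ρ)ᶜ ^ n)
      Filter.atTop (nhds 0) := by
    intro k
    refine ENNReal.tendsto_pow_atTop_nhds_zero_of_lt_one ?_
    -- In the sup norm, the `r`-ball lies in the cube `[-r, r]^(d+1)`.
    have hsub : ∀ j, (k : Fin (d + 1) → ℝ) j ∈ μ.support := by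
      intro j
      have hk := (norm_le_pi_norm (k : Fin (d + 1) → ℝ) j).trans
        (mem_ball_zero_iff.1 (hT k.2)).le
      exact hsupp (abs_le.1 hk)
    rw [prob_compl_eq_one_sub measurableSet_ball]
    exact ENNReal.sub_lt_self ENNReal.one_ne_top one_ne_zero (measure_pi_ball_pos hsub hρ).ne'
  have hsum : Filter.Tendsto
      (fun n : ℕ => ∑ k : T, ν (Metric.ball (k : Fin (d + 1) → ℝ) ρ)ᶜ ^ n)
      Filter.atTop (nhds 0) := by
    simpa using tendsto_finsetSum Finset.univ fun k _ => hpow k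
  obtain ⟨n, hn, hnpos⟩ := ((hsum.eventually (ge_mem_nhds (ENNReal.ofReal_pos.2 hδ.1))).and
    (Filter.eventually_gt_atTop 0)).exists
  refine ⟨n, hnpos, le_trans ?_ hn⟩
  calc P {ω | ¬ Approximates relu X f ε (fun i : Fin n => W i ω)}
      ≤ P (⋃ k : T, {ω | ∀ i < n, W i ω ∉ Metric.ball (k : Fin (d + 1) → ℝ) ρ}) := by
        refine measure_mono fun ω hω => ?_
        by_contra hcon
        refine hω (approximates_of_forall_exists_mem_ball happrox fun k => ?_)
        simp only [Set.mem_iUnion, Set.mem_ofPred_eq, not_exists, not_forall, not_not] at hcon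
        obtain ⟨i, hi, hmem⟩ := hcon k
        exact ⟨⟨i, hi⟩, hmem⟩
    _ ≤ ∑ k : T, P {ω | ∀ i < n, W i ω ∉ Metric.ball (k : Fin (d + 1) → ℝ) ρ} :=
        measure_iUnion_fintype_le _ _
    _ = ∑ k : T, ν (Metric.ball (k : Fin (d + 1) → ℝ) ρ)ᶜ ^ n :=
        Finset.sum_congr rfl fun k _ => measure_forall_lt_notMem hlaw hind measurableSet_ball n
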